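/- Throughout, $\|\cdot\|$ is the Euclidean norm and balls are closed. For integers $N,d,C\ge 2$, a dataset of size $N$ in $\mathbb{R}^d$ with $C$ classes is a set $\mathcal{D}\subseteq\mathbb{R}^d\times\{1,\dots,C\}$ of exactly $N$ pairs $(x,y)$ (data point, label). For $\delta>0$ it is $\delta$-separated if $$\min\{\|x-x'\| : (x,y),(x',y')\in\mathcal{D},\ y\ne y'\}=\delta .$$ For $\sigma\ge 0$, a linear map $T$ from $\mathbb{R}^d$ to a Euclidean space $\sigma$-preserves $\mathcal{D}$ if $\|a-a'\|\le\|Ta-Ta'\|$ for all $(x,y),(x',y')\in\mathcal{D}$ with $y\neq y'$ and all $a,a'\in\mathbb{R}^d$ with $\|a-x\|\le\sigma$ and $\|a'-x'\|\le\sigma$. **Theorem.** There exist universal constants $C_1,C_2>0$ such that for all integers $N,d,C\ge 2$ and $1\le k\le d-1$, and all reals $\delta>0$ and $0\le\sigma<\delta/2$: 1. If $\frac{\sigma}{\delta}<C_1\sqrt{\frac{k}{d}}\,N^{-2/k}$, then for every $\delta$-separated dataset $\mathcal{D}$ of size $N$ in $\mathbb{R}^d$ with $C$ classes there is a linear map $T:\mathbb{R}^d\to\mathbb{R}^k$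 that $\sigma$-preserves $\mathcal{D}$. Moreover, the map can be taken to be a scaled orthogonal projection: there is a $k$-dimensional subspace $W\subseteq\mathbb{R}^d$ such that $\frac{1}{\varepsilon}P_W$ $\sigma$-preserves $\mathcal{D}$, where $P_W$ is the orthogonal projection of $\mathbb{R}^d$ onto $W$ and $\varepsilon=2C_1\sqrt{\frac{k}{d}}\,N^{-2/k}$. 2. If $\frac{\sigma}{\delta}>C_2N^{-2/k}$, then there is a $\delta$-separated dataset $\mathcal{D}$ of size $N$ in $\mathbb{R}^d$ with two classes that no linear map $T:\mathbb{R}^d\to\mathbb{R}^k$ $\sigma$-preserves. -/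

import Mathlib

/-- A labeled dataset of size `N` in `ℝ^d` with `C` classes: a set of exactly `N` pairs
`(x, y)` of a data point `x` and a label `y`. -/
abbrev Dataset (d N C : ℕ) : Type :=
  {D : Finset (EuclideanSpace ℝ (Fin d) × Fin C) // D.card = N}

/-- `D` is `δ`-separated: `δ` is the minimal Euclidean distance between differently labeled
data points (and this minimum is attained). -/
def Dataset.IsSeparated {d N C : ℕ} (D : Dataset d N C) (δ : ℝ) : Prop :=
  IsLeast {r : ℝ | ∃ p ∈ D.1, ∃ q ∈ D.1, p.2 ≠ q.2 ∧ r = ‖p.1 - q.1‖} δ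

/-- The linear map `T` does not decrease the distance between any two points of the closed
`σ`-balls around differently labeled data points. -/
def Dataset.Preserves {d N C : ℕ} (D : Dataset d N C) (σ : ℝ)
    {F : Type*} [NormedAddCommGroup F] [NormedSpace ℝ F]
    (T : EuclideanSpace ℝ (Fin d) →ₗ[ℝ] F) : Prop :=
  ∀ p ∈ D.1, ∀ q ∈ D.1, p.2 ≠ q.2 →
    ∀ a ∈ Metric.closedBall p.1 σ, ∀ a' ∈ Metric.closedBall q.1 σ,
      ‖a - a'‖ ≤ ‖T a - T a'‖

/-- Some linear map into `ℝ^k` preserves `D`. -/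
def Dataset.HasPreservingMap {d N C : ℕ} (D : Dataset d N C) (σ : ℝ) (k : ℕ) : Prop :=
  ∃ T : EuclideanSpace ℝ (Fin d) →ₗ[ℝ] EuclideanSpace ℝ (Fin k), D.Preserves σ T

/-- `D` is preserved by `ε⁻¹ P`, where `P` is the orthogonal projection of `ℝ^d` onto some
`k`-dimensional subspace. -/
def Dataset.IsOrthogonallyPreservable {d N C : ℕ} (D : Dataset d N C) (σ ε : ℝ) (k : ℕ) : Prop :=
  ∃ W : Submodule ℝ (EuclideanSpace ℝ (Fin d)), Module.finrank ℝ W = k ∧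
    D.Preserves σ (ε⁻¹ • W.starProjection.toLinearMap)

/-!
In both parts only the differences of differently labeled points matter: whether a linear map
shrinks them too much depends on their directions.

**Upper bound.** Let `W` be a uniformly random `k`-dimensional subspace, realised as the image of a
coordinate subspace under a Haar-random orthogonal map. For a fixed vector `u`, averaging over a
Gaussian vector (`measure_unitary_apply_mem_le`) reduces the event `‖P_W u‖ ≤ s ‖u‖` to the event
that the first `k` coordinates of a Gaussian vector carry at most the fraction `s ^ 2` of its squared
length, and a Chernoff bound (`stdGaussian_sum_sq_le`) gives the probability
`(√e s √(d / k)) ^ k`. With `s = 3 ε` and `ε = (1 / 6) √(k / d) N ^ (-2 / k)` this is less than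
`N ^ (-2)`, so a union bound over the at most `N ^ 2` differences yields one `W` that works for all
of them. If `‖P_W v‖ ≥ 3 ε ‖v‖` and `‖w‖ ≤ 2 σ ≤ ε ‖v‖`, then
`‖P_W (v + w)‖ ≥ 2 ε ‖v‖ ≥ ε ‖v + w‖`, which is what the scaled projection has to satisfy.

**Lower bound.** A linear map to `ℝ ^ k` kills some unit vector `n` of a given copy of `ℝ ^ (k + 1)`.
If the line of `n` comes within `2 σ` of a difference `a - b` of differently labeled points, then the
`σ`-balls around `a` and `b` contain two distinct points with equal images. Hence it is enough to
build classes `A`, `B` of at most `N` points in total, at distance at least `1` from each other,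
whose differences come within `ρ ^ 2` of every direction, where `ρ` is of order `N ^ (-1 / k)`. Near
a given unit vector `v` the directions are `v + z` with `z ⟂ v` bounded, and `z` is approximated in
two scales: a `ρ`-net of a ball of bounded radius goes into `B`, a `ρ ^ 2`-net of the ball of radius
`ρ` goes into `A` (`exists_coversDirections_near`). Both have size `O(1 / ρ) ^ k`, which is how
`A.card * B.card` differences reach the resolution `ρ ^ 2`. The component `1` along `v` keeps the
classes apart. Exponentially many charts `v` cover the sphere, and their configurations are placed
far from each other (`exists_coversDirections_sphere`).
-/

open MeasureTheory ProbabilityTheory Module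

/-! ### Gaussian small ball estimate -/

theorem integrable_exp_mul_sq_gaussianReal {c : ℝ} (hc : c < 1) :
    Integrable (fun x : ℝ ↦ Real.exp (c * x ^ 2 / 2)) (gaussianReal 0 1) := by
  rw [gaussianReal_of_var_ne_zero _ one_ne_zero,
    integrable_withDensity_iff_integrable_smul' (by fun_prop) (by simp [gaussianPDF])]
  have h := (integrable_exp_neg_mul_sq (b := (1 - c) / 2) (by linarith)).const_mul (√(2 * Real.pi))⁻¹
  refine h.congr (Filter.Eventually.of_forall fun x ↦ ?_)
  simp only [toReal_gaussianPDF, gaussianPDFReal, NNReal.coe_one, mul_one, sub_zero, smul_eq_mul]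
  rw [mul_assoc, ← Real.exp_add]
  ring_nf

theorem integral_exp_mul_sq_gaussianReal {c : ℝ} (hc : c < 1) :
    ∫ x, Real.exp (c * x ^ 2 / 2) ∂gaussianReal 0 1 = (√(1 - c))⁻¹ := by
  rw [integral_gaussianReal_eq_integral_smul one_ne_zero]
  have : ∀ x : ℝ, gaussianPDFReal 0 1 x • Real.exp (c * x ^ 2 / 2) =
      (√(2 * Real.pi))⁻¹ * Real.exp (-((1 - c) / 2) * x ^ 2) := by
    intro x
    simp only [gaussianPDFReal, NNReal.coe_one, mul_one, sub_zero, smul_eq_mul]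
    rw [mul_assoc, ← Real.exp_add]
    ring_nf
  simp_rw [this]
  rw [integral_const_mul, integral_gaussian, ← Real.sqrt_inv, ← Real.sqrt_mul (by positivity),
    ← Real.sqrt_inv]
  congr 1
  have : 1 - c ≠ 0 := by linarith
  have := Real.pi_ne_zero
  field_simp

theorem integrable_exp_sum_mul_sq_stdGaussian {d : ℕ} {c : Fin d → ℝ} (hc : ∀ i, c i < 1) :
    Integrable (fun x : EuclideanSpace ℝ (Fin d) ↦ Real.exp (∑ i, c i * x i ^ 2 / 2))
      (stdGaussian (EuclideanSpace ℝ (Fin d))) := by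
  rw [← map_pi_eq_stdGaussian, integrable_map_measure (by fun_prop) (by fun_prop)]
  simp only [Function.comp_def, Real.exp_sum]
  exact Integrable.fintype_prod (f := fun i (t : ℝ) ↦ Real.exp (c i * t ^ 2 / 2))
    fun i ↦ integrable_exp_mul_sq_gaussianReal (hc i)

theorem integral_exp_sum_mul_sq_stdGaussian {d : ℕ} {c : Fin d → ℝ} (hc : ∀ i, c i < 1) :
    ∫ x : EuclideanSpace ℝ (Fin d), Real.exp (∑ i, c i * x i ^ 2 / 2)
      ∂stdGaussian (EuclideanSpace ℝ (Fin d)) = ∏ i, (√(1 - c i))⁻¹ := by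
  rw [← map_pi_eq_stdGaussian, integral_map (by fun_prop) (by fun_prop)]
  simp only [Real.exp_sum]
  rw [integral_fintype_prod_eq_prod (f := fun i (t : ℝ) ↦ Real.exp (c i * t ^ 2 / 2))]
  exact Finset.prod_congr rfl fun i _ ↦ integral_exp_mul_sq_gaussianReal (hc i)

theorem inv_sqrt_one_sub_pow_le {d k : ℕ} (hk : k < d) :
    (√(1 - (k : ℝ) / d))⁻¹ ^ (d - k) ≤ Real.exp (1 / 2) ^ k := by
  have hd : (0 : ℝ) < d := by exact_mod_cast Nat.zero_lt_of_lt hk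
  have hdk : (0 : ℝ) < (d : ℝ) - k := by
    have : (k : ℝ) < d := by exact_mod_cast hk
    linarith
  have h1 : (√(1 - (k : ℝ) / d))⁻¹ ≤ Real.exp ((k : ℝ) / (d - k) / 2) := by
    rw [← Real.sqrt_inv, Real.sqrt_le_left (Real.exp_pos _).le, ← Real.exp_nat_mul]
    calc (1 - (k : ℝ) / d)⁻¹ = (k : ℝ) / (d - k) + 1 := by
          have : (1 - (k : ℝ) / d) = (d - k) / d := by field_simp
          rw [this]; field_simp; ring
      _ ≤ Real.exp ((k : ℝ) / (d - k)) := Real.add_one_le_exp _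
      _ = _ := by push_cast; ring_nf
  calc _ ≤ Real.exp ((k : ℝ) / (d - k) / 2) ^ (d - k) :=
        pow_le_pow_left₀ (by positivity) h1 _
    _ = _ := by
        rw [← Real.exp_nat_mul, ← Real.exp_nat_mul, Nat.cast_sub hk.le]
        congr 1
        field_simp

/-- Chernoff bound: the first `k` of `d` independent standard Gaussians carry at most the
fraction `s ^ 2` of the squared length with probability at most `(√e s √(d / k)) ^ k`. -/
theorem stdGaussian_sum_sq_le {d k : ℕ} (hk0 : 0 < k) (hk : k < d) {s : ℝ} (hs : 0 < s) :
    (stdGaussian (EuclideanSpace ℝ (Fin d))).real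
      {x | ∑ i : Fin d with i.1 < k, x i ^ 2 ≤ s ^ 2 * ‖x‖ ^ 2} ≤
      (Real.exp (1 / 2) * s * √((d : ℝ) / k)) ^ k := by
  have hd : (0 : ℝ) < d := by exact_mod_cast Nat.zero_lt_of_lt hk
  have hk0' : (0 : ℝ) < k := by exact_mod_cast hk0
  have hkd : (k : ℝ) / d < 1 := by rw [div_lt_one hd]; exact_mod_cast hk
  -- `∑ i, c i * x i ^ 2` is `λ (s ^ 2 ‖x‖ ^ 2 - ∑ i < k, x i ^ 2)` with `λ s ^ 2 = k / d`, the value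
  -- that is optimal in the limit of small `s`
  let c : Fin d → ℝ := fun i ↦ if i.1 < k then k / d - k / (d * s ^ 2) else k / d
  have hc : ∀ i, c i < 1 := by
    intro i
    have : (0 : ℝ) < k / (d * s ^ 2) := by positivity
    simp only [c]
    split_ifs <;> linarith
  have hexp : ∀ x : EuclideanSpace ℝ (Fin d), ∑ i, c i * x i ^ 2 / 2 =
      k / (d * s ^ 2) * (s ^ 2 * ‖x‖ ^ 2 - ∑ i : Fin d with i.1 < k, x i ^ 2) / 2 := by
    intro x
    rw [EuclideanSpace.real_norm_sq_eq, Finset.sum_filter, Finset.mul_sum, ← Finset.sum_sub_distrib,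
      Finset.mul_sum, Finset.sum_div]
    refine Finset.sum_congr rfl fun i _ ↦ ?_
    simp only [c]
    split_ifs
    · field_simp
    · field_simp
      ring
  have hmarkov := mul_meas_ge_le_integral_of_nonneg
    (Filter.Eventually.of_forall fun x ↦ (Real.exp_pos _).le)
    (integrable_exp_sum_mul_sq_stdGaussian hc) 1
  rw [integral_exp_sum_mul_sq_stdGaussian hc, one_mul] at hmarkov
  have hprod : ∏ i, (√(1 - c i))⁻¹ =
      (√(1 - (k / d - k / (d * s ^ 2))))⁻¹ ^ k * (√(1 - (k : ℝ) / d))⁻¹ ^ (d - k) := by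
    have h1 : ∀ i, (√(1 - c i))⁻¹ = if i.1 < k then (√(1 - (k / d - k / (d * s ^ 2))))⁻¹
        else (√(1 - (k : ℝ) / d))⁻¹ := by
      intro i; simp only [c]; split_ifs <;> rfl
    have h2 : (Finset.univ.filter fun i : Fin d ↦ i.1 < k).card = k := by
      rw [Fin.card_filter_val_lt]; omega
    have h3 : (Finset.univ.filter fun i : Fin d ↦ ¬ i.1 < k).card = d - k := by
      have := Finset.card_filter_add_card_filter_not (s := Finset.univ) (fun i : Fin d ↦ i.1 < k)
      rw [h2, Finset.card_univ, Fintype.card_fin] at this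
      omega
    simp_rw [h1]
    rw [Finset.prod_ite, Finset.prod_const, Finset.prod_const, h2, h3]
  have hα : (√(1 - (k / d - k / (d * s ^ 2))))⁻¹ ≤ s * √((d : ℝ) / k) := by
    calc _ ≤ (√((k : ℝ) / (d * s ^ 2)))⁻¹ := by
          apply inv_anti₀ (by positivity)
          apply Real.sqrt_le_sqrt
          linarith
      _ = _ := by
          rw [← Real.sqrt_inv, inv_div, mul_div_right_comm, mul_comm, Real.sqrt_mul (by positivity),
            Real.sqrt_sq hs.le]
  refine le_trans (measureReal_mono fun x hx ↦ ?_) (hmarkov.trans ?_)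
  · rw [Set.mem_ofPred_eq] at hx ⊢
    rw [hexp, Real.one_le_exp_iff]
    have := sub_nonneg.2 hx
    positivity
  · rw [hprod]
    calc _ ≤ (s * √((d : ℝ) / k)) ^ k * Real.exp (1 / 2) ^ k := by
          gcongr
          exact inv_sqrt_one_sub_pow_le hk
      _ = _ := by rw [← mul_pow]; ring

/-! ### Random rotations and random subspaces -/

theorem compactSpace_unitary_clm (E : Type*) [NormedAddCommGroup E] [InnerProductSpace ℝ E]
    [FiniteDimensional ℝ E] : CompactSpace (unitary (E →L[ℝ] E)) := by
  have : ProperSpace (E →L[ℝ] E) := FiniteDimensional.proper ℝ _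
  suffices h : IsCompact (unitary (E →L[ℝ] E) : Set (E →L[ℝ] E)) from
    isCompact_iff_compactSpace.1 h
  refine Metric.isCompact_of_isClosed_isBounded isClosed_unitary
    ((Metric.isBounded_closedBall (x := 0) (r := 1)).subset fun u hu ↦ ?_)
  rw [mem_closedBall_zero_iff]
  refine ContinuousLinearMap.opNorm_le_bound _ zero_le_one fun x ↦ ?_
  rw [one_mul]
  exact (Unitary.norm_map (⟨u, hu⟩ : unitary (E →L[ℝ] E)) x).le

/-- The orthogonal group is transitive on spheres: a reflection takes `u` to `v`. -/
theorem exists_unitary_apply_eq {E : Type*} [NormedAddCommGroup E] [InnerProductSpace ℝ E]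
    [FiniteDimensional ℝ E] {u v : E} (h : ‖u‖ = ‖v‖) :
    ∃ R : unitary (E →L[ℝ] E), (R : E →L[ℝ] E) u = v := by
  refine ⟨Unitary.linearIsometryEquiv.symm (Submodule.reflection (Submodule.span ℝ {u - v})ᗮ), ?_⟩
  rw [Unitary.coe_symm_linearIsometryEquiv_apply]
  exact Submodule.reflection_sub h

/-- A Haar-random orthogonal map sends a fixed nonzero vector into a closed cone with at most the
Gaussian measure of the cone: the probability does not depend on the vector, so it may be averaged
over a Gaussian vector, whose law is rotation invariant. -/
theorem measure_unitary_apply_mem_le {E : Type*} [NormedAddCommGroup E] [InnerProductSpace ℝ E]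
    [FiniteDimensional ℝ E] [MeasurableSpace E] [BorelSpace E]
    [MeasurableSpace (unitary (E →L[ℝ] E))] [BorelSpace (unitary (E →L[ℝ] E))]
    (μ : Measure (unitary (E →L[ℝ] E))) [IsProbabilityMeasure μ] [μ.IsMulLeftInvariant]
    {S : Set E} (hS : IsClosed S) (hcone : ∀ t : ℝ, ∀ x ∈ S, t • x ∈ S) {u : E} (hu : u ≠ 0) :
    μ {Q | ((Q⁻¹ : unitary (E →L[ℝ] E)) : E →L[ℝ] E) u ∈ S} ≤ stdGaussian E S := by
  set f : unitary (E →L[ℝ] E) × E → E := fun p ↦ ((p.1⁻¹ : unitary (E →L[ℝ] E)) : E →L[ℝ] E) p.2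
  have hf : Continuous f := by
    have : Continuous fun p : unitary (E →L[ℝ] E) × E ↦
        ((p.1⁻¹ : unitary (E →L[ℝ] E)) : E →L[ℝ] E) :=
      continuous_subtype_val.comp (continuous_inv.comp continuous_fst)
    exact this.clm_apply continuous_snd
  have hmeas : MeasurableSet (f ⁻¹' S) := (hS.preimage hf).measurableSet
  have hle : ∀ x : E, μ {Q | f (Q, u) ∈ S} ≤ μ {Q | f (Q, x) ∈ S} := by
    intro x
    rcases eq_or_ne x 0 with rfl | hx
    -- a nonempty cone contains `0`
    · refine measure_mono fun Q hQ ↦ ?_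
      have := hcone 0 _ hQ
      simpa [f] using this
    · obtain ⟨R, hR⟩ := exists_unitary_apply_eq (u := (‖x‖ / ‖u‖) • u) (v := x) (by
        rw [norm_smul, norm_div, norm_norm, norm_norm, div_mul_cancel₀ _ (norm_ne_zero_iff.2 hu)])
      have hpre : {Q | f (Q, x) ∈ S} = (R⁻¹ * ·) ⁻¹' {Q | f (Q, (‖x‖ / ‖u‖) • u) ∈ S} := by
        ext Q
        simp only [f, Set.mem_ofPred_eq, Set.mem_preimage, mul_inv_rev, inv_inv]
        nth_rewrite 1 [← hR]
        rfl
      rw [hpre, measure_preimage_mul]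
      refine measure_mono fun Q hQ ↦ ?_
      have := hcone (‖x‖ / ‖u‖) _ hQ
      simpa [f] using this
  calc μ {Q | f (Q, u) ∈ S} = ∫⁻ _, μ {Q | f (Q, u) ∈ S} ∂stdGaussian E := by simp
    _ ≤ ∫⁻ x, μ {Q | f (Q, x) ∈ S} ∂stdGaussian E := lintegral_mono hle
    _ = (μ.prod (stdGaussian E)) (f ⁻¹' S) := (Measure.prod_apply_symm hmeas).symm
    _ = ∫⁻ Q, stdGaussian E {x | f (Q, x) ∈ S} ∂μ := Measure.prod_apply hmeas
    _ = ∫⁻ _, stdGaussian E S ∂μ := by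
        refine lintegral_congr fun Q ↦ ?_
        conv_rhs => rw [← stdGaussian_map (Unitary.linearIsometryEquiv Q⁻¹)]
        rw [Measure.map_apply (by fun_prop) hS.measurableSet]
        rfl
    _ = stdGaussian E S := by simp

/-- Union bound over a random rotation. -/
theorem exists_linearIsometryEquiv_forall_notMem {E : Type*} [NormedAddCommGroup E]
    [InnerProductSpace ℝ E] [FiniteDimensional ℝ E] [MeasurableSpace E] [BorelSpace E]
    {S : Set E} (hS : IsClosed S) (hcone : ∀ t : ℝ, ∀ x ∈ S, t • x ∈ S) {U : Finset E}
    (hU : ∀ u ∈ U, u ≠ 0) (hcard : U.card * (stdGaussian E).real S < 1) :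
    ∃ Q : E ≃ₗᵢ[ℝ] E, ∀ u ∈ U, Q.symm u ∉ S := by
  borelize ↥(unitary (E →L[ℝ] E))
  have := compactSpace_unitary_clm E
  let μ : Measure (unitary (E →L[ℝ] E)) := Measure.haarMeasure ⊤
  have : IsProbabilityMeasure μ := ⟨by
    simpa using Measure.haarMeasure_self
      (K₀ := (⊤ : TopologicalSpace.PositiveCompacts (unitary (E →L[ℝ] E))))⟩
  have hlt : μ (⋃ u ∈ U, {Q | ((Q⁻¹ : unitary (E →L[ℝ] E)) : E →L[ℝ] E) u ∈ S}) < μ Set.univ := by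
    rw [measure_univ]
    calc _ ≤ ∑ u ∈ U, μ {Q | ((Q⁻¹ : unitary (E →L[ℝ] E)) : E →L[ℝ] E) u ∈ S} :=
          measure_biUnion_finset_le _ _
      _ ≤ ∑ u ∈ U, stdGaussian E S :=
          Finset.sum_le_sum fun u hu ↦ measure_unitary_apply_mem_le μ hS hcone (hU u hu)
      _ = ENNReal.ofReal (U.card * (stdGaussian E).real S) := by
          rw [Finset.sum_const, nsmul_eq_mul, ENNReal.ofReal_mul (by positivity),
            ofReal_measureReal, ENNReal.ofReal_natCast]
      _ < 1 := by rwa [ENNReal.ofReal_lt_one]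
  obtain ⟨Q, hQ⟩ := (Set.ne_univ_iff_exists_notMem _).1 (ne_of_apply_ne μ hlt.ne)
  refine ⟨Unitary.linearIsometryEquiv Q, fun u hu h ↦ hQ ?_⟩
  exact Set.mem_biUnion (by exact hu) h

/-- Finitely many nonzero vectors have a common `k`-dimensional subspace onto which each of them
projects with length more than `s` times its own. -/
theorem exists_submodule_forall_norm_starProjection {d k : ℕ} (hk0 : 0 < k) (hk : k < d) {s : ℝ}
    (hs : 0 < s) {U : Finset (EuclideanSpace ℝ (Fin d))} (hU : ∀ u ∈ U, u ≠ 0)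
    (hcard : U.card * (Real.exp (1 / 2) * s * √((d : ℝ) / k)) ^ k < 1) :
    ∃ W : Submodule ℝ (EuclideanSpace ℝ (Fin d)), Module.finrank ℝ W = k ∧
      ∀ u ∈ U, s * ‖u‖ < ‖W.starProjection u‖ := by
  let S : Set (EuclideanSpace ℝ (Fin d)) := {x | ∑ i : Fin d with i.1 < k, x i ^ 2 ≤ s ^ 2 * ‖x‖ ^ 2}
  have hS : IsClosed S := isClosed_le (by fun_prop) (by fun_prop)
  have hcone : ∀ t : ℝ, ∀ x ∈ S, t • x ∈ S := by
    intro t x hx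
    have h : t ^ 2 * ∑ i : Fin d with i.1 < k, x i ^ 2 ≤ t ^ 2 * (s ^ 2 * ‖x‖ ^ 2) :=
      mul_le_mul_of_nonneg_left hx (sq_nonneg t)
    rw [Finset.mul_sum] at h
    simp only [S, Set.mem_ofPred_eq, PiLp.smul_apply, smul_eq_mul, norm_smul, mul_pow,
      Real.norm_eq_abs, sq_abs]
    linarith
  obtain ⟨Q, hQ⟩ := exists_linearIsometryEquiv_forall_notMem hS hcone hU
    ((mul_le_mul_of_nonneg_left (stdGaussian_sum_sq_le hk0 hk hs) (Nat.cast_nonneg _)).trans_lt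
      hcard)
  let b : OrthonormalBasis (Fin d) ℝ (EuclideanSpace ℝ (Fin d)) :=
    (EuclideanSpace.basisFun (Fin d) ℝ).map Q
  have hb : ∀ i x, inner ℝ (b i) x = (Q.symm x) i := by
    intro i x
    rw [OrthonormalBasis.map_apply, ← Q.symm.inner_map_map, Q.symm_apply_apply,
      EuclideanSpace.basisFun_inner]
  let I : Finset (Fin d) := Finset.univ.filter fun i ↦ i.1 < k
  have hI : I.card = k := by
    rw [Fin.card_filter_val_lt]; omega
  have hli : LinearIndependent ℝ fun i : I ↦ b i :=
    b.orthonormal.linearIndependent.comp _ Subtype.val_injective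
  let W : Submodule ℝ (EuclideanSpace ℝ (Fin d)) := Submodule.span ℝ (Set.range fun i : I ↦ b i)
  refine ⟨W, by rw [finrank_span_eq_card hli, Fintype.card_coe, hI], fun u hu ↦ ?_⟩
  have hmem : ∀ i ∈ I, b i ∈ W := fun i hi ↦ Submodule.subset_span ⟨⟨i, hi⟩, rfl⟩
  have hproj : ∑ i ∈ I, (Q.symm u) i ^ 2 ≤ ‖W.starProjection u‖ ^ 2 := by
    rw [← b.sum_sq_inner_right]
    calc _ = ∑ i ∈ I, inner ℝ (b i) (W.starProjection u) ^ 2 := by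
          refine Finset.sum_congr rfl fun i hi ↦ ?_
          have h0 := W.starProjection_inner_eq_zero u (b i) (hmem i hi)
          rw [real_inner_comm, inner_sub_right, sub_eq_zero] at h0
          rw [← hb, h0]
      _ ≤ _ := Finset.sum_le_univ_sum_of_nonneg fun i ↦ sq_nonneg _
  have hu' : s ^ 2 * ‖u‖ ^ 2 < ∑ i ∈ I, (Q.symm u) i ^ 2 := by
    have := hQ u hu
    simp only [S, Set.mem_ofPred_eq, not_le, LinearIsometryEquiv.norm_map] at this
    exact this
  refine lt_of_pow_lt_pow_left₀ 2 (norm_nonneg _) ?_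
  rw [mul_pow]
  exact hu'.trans_le hproj

/-! ### Preservation by scaled projections -/

/-- A subspace onto which every difference of differently labeled points projects with at least
`3 ε` of its length is robust enough for the scaled projection to preserve the `σ`-balls. -/
theorem Dataset.preserves_inv_smul_starProjection {d N C : ℕ} {D : Dataset d N C} {σ δ ε : ℝ}
    (hε0 : 0 < ε) (hε1 : ε ≤ 1) (hσ : 2 * σ ≤ ε * δ) (hD : D.IsSeparated δ)
    {W : Submodule ℝ (EuclideanSpace ℝ (Fin d))}
    (hW : ∀ p ∈ D.1, ∀ q ∈ D.1, p.2 ≠ q.2 →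
      3 * ε * ‖p.1 - q.1‖ ≤ ‖W.starProjection (p.1 - q.1)‖) :
    D.Preserves σ (ε⁻¹ • W.starProjection.toLinearMap) := by
  intro p hp q hq hpq a ha a' ha'
  have hδ : δ ≤ ‖p.1 - q.1‖ := hD.2 ⟨p, hp, q, hq, hpq, rfl⟩
  rw [mem_closedBall_iff_norm] at ha ha'
  set v := p.1 - q.1
  have hw : ‖(a - p.1) - (a' - q.1)‖ ≤ ε * ‖v‖ := by
    have := norm_sub_le (a - p.1) (a' - q.1)
    have := mul_le_mul_of_nonneg_left hδ hε0.le
    linarith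
  set w := (a - p.1) - (a' - q.1)
  have haa : a - a' = v + w := by simp only [v, w]; abel
  have hPw : ‖W.starProjection w‖ ≤ ‖w‖ := W.norm_starProjection_apply_le w
  have hP : ‖W.starProjection v‖ - ‖W.starProjection w‖ ≤ ‖W.starProjection (v + w)‖ := by
    rw [map_add]
    simpa using norm_sub_norm_le (W.starProjection v) (-W.starProjection w)
  rw [← map_sub, LinearMap.smul_apply, norm_smul, norm_inv, Real.norm_of_nonneg hε0.le, haa,
    ← div_eq_inv_mul, le_div_iff₀ hε0]
  have h1 : ‖v + w‖ ≤ 2 * ‖v‖ := by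
    have := norm_add_le v w
    have := mul_le_of_le_one_left (norm_nonneg v) hε1
    linarith
  have h2 := mul_le_mul_of_nonneg_left h1 hε0.le
  have h3 := hW p hp q hq hpq
  change ‖v + w‖ * ε ≤ ‖W.starProjection (v + w)‖
  linarith

theorem Dataset.IsOrthogonallyPreservable.hasPreservingMap {d N C k : ℕ} {D : Dataset d N C}
    {σ ε : ℝ} (h : D.IsOrthogonallyPreservable σ ε k) : D.HasPreservingMap σ k := by
  obtain ⟨W, hW, hP⟩ := h
  let e := (stdOrthonormalBasis ℝ W).reindex (finCongr hW)
  refine ⟨e.repr.toLinearEquiv.toLinearMap ∘ₗ (ε⁻¹ • W.orthogonalProjectionOnto.toLinearMap), ?_⟩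
  intro p hp q hq hpq a ha a' ha'
  refine (hP p hp q hq hpq a ha a' ha').trans_eq ?_
  rw [← map_sub, ← map_sub]
  simp only [LinearMap.comp_apply, LinearMap.smul_apply]
  change _ = ‖e.repr _‖
  rw [LinearIsometryEquiv.norm_map, norm_smul, norm_smul]
  rfl

/-- With `s = 3 ε` each of the at most `N ^ 2` differences of differently labeled points is
shrunk too much with probability at most `(√e / 2) ^ k / N ^ 2`, so that `√e < 2` suffices. -/
theorem Dataset.IsSeparated.isOrthogonallyPreservable {d N C k : ℕ} {D : Dataset d N C} {σ δ : ℝ}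
    (hD : D.IsSeparated δ) (hN : 0 < N) (hk0 : 0 < k) (hk : k < d) (hδ : 0 < δ)
    (hσ : σ / δ < 1 / 12 * √((k : ℝ) / d) * (N : ℝ) ^ (-(2 / (k : ℝ)))) :
    D.IsOrthogonallyPreservable σ
      (2 * (1 / 12) * √((k : ℝ) / d) * (N : ℝ) ^ (-(2 / (k : ℝ)))) k := by
  have hd : (0 : ℝ) < d := by exact_mod_cast Nat.zero_lt_of_lt hk
  have hk0' : (0 : ℝ) < k := by exact_mod_cast hk0
  have hN' : (1 : ℝ) ≤ N := by exact_mod_cast hN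
  set η : ℝ := (N : ℝ) ^ (-(2 / (k : ℝ)))
  have hη0 : 0 < η := Real.rpow_pos_of_pos (by linarith) _
  have hη1 : η ≤ 1 := Real.rpow_le_one_of_one_le_of_nonpos hN' (by
    rw [neg_nonpos]; positivity)
  have hη : η ^ k = ((N : ℝ) ^ 2)⁻¹ := by
    rw [← Real.rpow_natCast, ← Real.rpow_mul (by linarith), neg_mul, div_mul_cancel₀ _ hk0'.ne',
      Real.rpow_neg (by linarith), Real.rpow_two]
  have hs1 : √((k : ℝ) / d) ≤ 1 := by
    rw [Real.sqrt_le_one, div_le_one hd]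
    exact_mod_cast hk.le
  have hs0 : 0 < √((k : ℝ) / d) := Real.sqrt_pos.2 (by positivity)
  set ε : ℝ := 2 * (1 / 12) * √((k : ℝ) / d) * η with hε
  have hε0 : 0 < ε := by positivity
  have hε1 : ε ≤ 1 := by
    have := mul_le_one₀ hs1 hη0.le hη1
    rw [hε]
    linarith
  classical
  let U : Finset (EuclideanSpace ℝ (Fin d)) :=
    ((D.1 ×ˢ D.1).filter fun pq ↦ pq.1.2 ≠ pq.2.2).image fun pq ↦ pq.1.1 - pq.2.1
  have hmem : ∀ p ∈ D.1, ∀ q ∈ D.1, p.2 ≠ q.2 → p.1 - q.1 ∈ U := by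
    intro p hp q hq hpq
    exact Finset.mem_image.2 ⟨(p, q), by simp [hp, hq, hpq], rfl⟩
  have hU : ∀ u ∈ U, u ≠ 0 := by
    intro u hu
    obtain ⟨⟨p, q⟩, hpq, rfl⟩ := Finset.mem_image.1 hu
    simp only [Finset.mem_filter, Finset.mem_product] at hpq
    exact norm_pos_iff.1 (hδ.trans_le (hD.2 ⟨p, hpq.1.1, q, hpq.1.2, hpq.2, rfl⟩))
  have hcardU : (U.card : ℝ) ≤ N ^ 2 := by
    have : U.card ≤ N ^ 2 := by
      refine Finset.card_image_le.trans ((Finset.card_filter_le _ _).trans ?_)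
      rw [Finset.card_product, D.2, sq]
    exact_mod_cast this
  have hexp : Real.exp (1 / 2) < 2 := by
    refine lt_of_pow_lt_pow_left₀ 2 (by norm_num) ?_
    rw [← Real.exp_nat_mul]
    have := Real.exp_one_lt_d9
    norm_num
    linarith
  have hbase : Real.exp (1 / 2) * (3 * ε) * √((d : ℝ) / k) = Real.exp (1 / 2) / 2 * η := by
    have : √((k : ℝ) / d) * √((d : ℝ) / k) = 1 := by
      rw [← Real.sqrt_mul (by positivity), div_mul_div_cancel₀ hd.ne', div_self hk0'.ne',
        Real.sqrt_one]
    calc _ = Real.exp (1 / 2) / 2 * η * (√((k : ℝ) / d) * √((d : ℝ) / k)) := by rw [hε]; ring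
      _ = _ := by rw [this, mul_one]
  have hcard : U.card * (Real.exp (1 / 2) * (3 * ε) * √((d : ℝ) / k)) ^ k < 1 := by
    rw [hbase, mul_pow, hη]
    calc _ ≤ (N : ℝ) ^ 2 * ((Real.exp (1 / 2) / 2) ^ k * ((N : ℝ) ^ 2)⁻¹) := by gcongr
      _ = (Real.exp (1 / 2) / 2) ^ k := by
          have : (N : ℝ) ≠ 0 := by linarith
          field_simp
      _ < 1 := pow_lt_one₀ (by positivity) (by linarith) hk0.ne'
  obtain ⟨W, hWk, hW⟩ := exists_submodule_forall_norm_starProjection hk0 hk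
    (by positivity) hU hcard
  refine ⟨W, hWk, Dataset.preserves_inv_smul_starProjection hε0 hε1 ?_ hD
    fun p hp q hq hpq ↦ (hW _ (hmem p hp q hq hpq)).le⟩
  rw [div_lt_iff₀ hδ] at hσ
  rw [hε]
  linarith

/-! ### Nets and configurations that cover all directions -/

/-- A maximal `r`-separated subset of a bounded set is an `r`-net of it, and a volume comparison
bounds its size. -/
theorem exists_finset_net {F : Type*} [NormedAddCommGroup F] [NormedSpace ℝ F]
    [FiniteDimensional ℝ F] {S : Set F} {R r : ℝ} (hr : 0 < r) (hR : 0 ≤ R)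
    (hS : ∀ x ∈ S, ‖x‖ ≤ R) :
    ∃ t : Finset F, (∀ y ∈ t, y ∈ S) ∧ (∀ x ∈ S, ∃ y ∈ t, ‖x - y‖ ≤ r) ∧
      (t.card : ℝ) ≤ (1 + 2 * R / r) ^ finrank ℝ F := by
  classical
  let P : Finset F → Prop := fun t ↦
    (∀ y ∈ t, y ∈ S) ∧ ∀ x ∈ t, ∀ y ∈ t, x ≠ y → r ≤ ‖x - y‖
  have hP : ∀ t, P t → (t.card : ℝ) ≤ (1 + 2 * R / r) ^ finrank ℝ F := by
    intro t ht
    borelize F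
    let μ : MeasureTheory.Measure F := MeasureTheory.Measure.addHaar
    have hdisj : Set.Pairwise (t : Set F)
        (Function.onFun Disjoint fun c ↦ Metric.ball (c : F) (r / 2)) := by
      intro c hc e he hce
      apply Metric.ball_disjoint_ball
      rw [dist_eq_norm, add_halves]
      exact ht.2 c hc e he hce
    have hsub : (⋃ c ∈ t, Metric.ball c (r / 2)) ⊆ Metric.ball (0 : F) (R + r / 2) := by
      refine Set.iUnion₂_subset fun x hx ↦ Metric.ball_subset_ball' ?_
      rw [dist_zero_right]
      linarith [hS x (ht.1 x hx)]
    have hvol : (t.card : ENNReal) * ENNReal.ofReal ((r / 2) ^ finrank ℝ F) *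
        μ (Metric.ball 0 1) ≤ ENNReal.ofReal ((R + r / 2) ^ finrank ℝ F) * μ (Metric.ball 0 1) := by
      have hm := MeasureTheory.measure_mono (μ := μ) hsub
      rw [MeasureTheory.measure_biUnion_finset hdisj fun c _ ↦ measurableSet_ball] at hm
      simp only [μ.addHaar_ball_of_pos _ (half_pos hr),
        μ.addHaar_ball_of_pos _ (show 0 < R + r / 2 by positivity), Finset.sum_const,
        nsmul_eq_mul] at hm
      rwa [mul_assoc]
    have hle := (ENNReal.mul_le_mul_iff_left (Metric.measure_ball_pos μ _ zero_lt_one).ne'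
      MeasureTheory.measure_ball_lt_top.ne).1 hvol
    have hreal := ENNReal.toReal_le_of_le_ofReal (by positivity) hle
    rw [ENNReal.toReal_mul, ENNReal.toReal_natCast, ENNReal.toReal_ofReal (by positivity),
      ← le_div_iff₀ (by positivity), ← div_pow] at hreal
    refine hreal.trans_eq ?_
    congr 1
    field_simp
    ring
  -- the sizes of the separated subsets are bounded, so one of them has maximal size
  let K : Set ℕ := {n | ∃ t, P t ∧ t.card = n}
  have hK : BddAbove K := by
    refine ⟨⌈(1 + 2 * R / r) ^ finrank ℝ F⌉₊, ?_⟩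
    rintro _ ⟨t, ht, rfl⟩
    exact_mod_cast (hP t ht).trans (Nat.le_ceil _)
  obtain ⟨t, ht, htK⟩ := Nat.sSup_mem (s := K) ⟨0, ∅, by simp [P], rfl⟩ hK
  refine ⟨t, ht.1, fun x hx ↦ ?_, hP t ht⟩
  by_contra! hfar
  have hxt : x ∉ t := fun h ↦ by
    have := hfar x h
    rw [sub_self, norm_zero] at this
    linarith
  have hins : P (insert x t) := by
    refine ⟨?_, ?_⟩
    · intro y hy
      rcases Finset.mem_insert.1 hy with rfl | hy
      exacts [hx, ht.1 y hy]
    · intro y hy z hz hyz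
      rcases Finset.mem_insert.1 hy with hy | hy <;> rcases Finset.mem_insert.1 hz with hz | hz
      · exact absurd (hy.trans hz.symm) hyz
      · rw [hy]; exact (hfar z hz).le
      · rw [hz, norm_sub_rev]; exact (hfar y hy).le
      · exact ht.2 y hy z hz hyz
  have := le_csSup hK ⟨_, hins, rfl⟩
  rw [Finset.card_insert_of_notMem hxt, ← htK] at this
  omega

/-- The points of `A` and `B` are at distance at least `1` from each other, and every vector of `S`
spans a line that comes within `η` of some difference `a - b`. -/
def CoversDirections {E : Type*} [NormedAddCommGroup E] [NormedSpace ℝ E] (A B : Finset E)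
    (S : Set E) (η : ℝ) : Prop :=
  (∀ a ∈ A, ∀ b ∈ B, 1 ≤ ‖a - b‖) ∧
    ∀ n ∈ S, ∃ a ∈ A, ∃ b ∈ B, ∃ t : ℝ, ‖a - b - t • n‖ ≤ η

/-- The directions near a unit vector `v` are charted by `v + z` with `z ⟂ v` of length at most
`3`. A `ρ`-net of that ball in `vᗮ` has size `O(1 / ρ) ^ k`, and so has a `ρ ^ 2`-net of the ball of
radius `ρ`; the sums of their points form a `ρ ^ 2`-net of the large ball. -/
theorem exists_coversDirections_near {E : Type*} [NormedAddCommGroup E] [InnerProductSpace ℝ E]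
    [FiniteDimensional ℝ E] {k : ℕ} (hE : finrank ℝ E = k + 1) {v : E} (hv : ‖v‖ = 1) {ρ : ℝ}
    (hρ0 : 0 < ρ) (hρ1 : ρ ≤ 1) :
    ∃ A B : Finset E, (A.card + B.card : ℝ) ≤ 2 * (7 / ρ) ^ k ∧
      CoversDirections A B {n | ‖n‖ = 1 ∧ ‖n - v‖ ≤ 1} (ρ ^ 2) := by
  classical
  have hv0 : v ≠ 0 := by rw [← norm_ne_zero_iff, hv]; norm_num
  have hfr : finrank ℝ (Submodule.span ℝ {v})ᗮ = k := by
    have : Fact (finrank ℝ E = k + 1) := ⟨hE⟩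
    exact Submodule.finrank_orthogonal_span_singleton hv0
  obtain ⟨t₁, -, ht₁, ht₁c⟩ := exists_finset_net (F := (Submodule.span ℝ {v})ᗮ)
    (S := {z | ‖z‖ ≤ 3}) (R := 3) hρ0 (by norm_num) fun x hx ↦ hx
  obtain ⟨t₂, -, ht₂, ht₂c⟩ := exists_finset_net (F := (Submodule.span ℝ {v})ᗮ)
    (S := {z | ‖z‖ ≤ ρ}) (R := ρ) (r := ρ ^ 2) (by positivity) hρ0.le fun x hx ↦ hx
  rw [hfr] at ht₁c ht₂c
  have hb : (1 : ℝ) ≤ 1 / ρ := by rwa [le_div_iff₀ hρ0, one_mul]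
  have hc₁ : (t₁.card : ℝ) ≤ (7 / ρ) ^ k := by
    refine ht₁c.trans (pow_le_pow_left₀ (by positivity) ?_ _)
    calc 1 + 2 * 3 / ρ ≤ 1 / ρ + 2 * 3 / ρ := by gcongr
      _ = 7 / ρ := by ring
  have hc₂ : (t₂.card : ℝ) ≤ (7 / ρ) ^ k := by
    refine ht₂c.trans (pow_le_pow_left₀ (by positivity) ?_ _)
    calc 1 + 2 * ρ / ρ ^ 2 = 1 + 2 / ρ := by field_simp
      _ ≤ 1 / ρ + 2 / ρ := by gcongr
      _ = 3 / ρ := by ring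
      _ ≤ 7 / ρ := by gcongr; norm_num
  refine ⟨t₂.image fun z : (Submodule.span ℝ {v})ᗮ ↦ v + (z : E), t₁.image fun z : (Submodule.span ℝ {v})ᗮ ↦ -(z : E), ?_, ?_, ?_⟩
  · have h₁ : ((t₁.image fun z : (Submodule.span ℝ {v})ᗮ ↦ -(z : E)).card : ℝ) ≤ t₁.card := by
      exact_mod_cast Finset.card_image_le
    have h₂ : ((t₂.image fun z : (Submodule.span ℝ {v})ᗮ ↦ v + (z : E)).card : ℝ) ≤ t₂.card := by
      exact_mod_cast Finset.card_image_le
    linarith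
  · intro a ha b hb
    obtain ⟨z, -, rfl⟩ := Finset.mem_image.1 ha
    obtain ⟨y, -, rfl⟩ := Finset.mem_image.1 hb
    have hz := Submodule.mem_orthogonal_singleton_iff_inner_right.1 z.2
    have hy := Submodule.mem_orthogonal_singleton_iff_inner_right.1 y.2
    have h1 : inner ℝ v (v + z - -(y : E)) = 1 := by
      rw [sub_neg_eq_add, inner_add_right, inner_add_right, hz, hy, real_inner_self_eq_norm_sq, hv]
      norm_num
    have := real_inner_le_norm v (v + z - -(y : E))
    rwa [h1, hv, one_mul] at this
  -- the line of `n` meets `v + vᗮ` in `v + x`, and `x` is approximated by `y + z` with `y` in the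
  -- coarse net and `z` in the fine net
  · rintro n ⟨hn, hnv⟩
    have hc : 1 / 2 ≤ inner ℝ v n := by
      have h := norm_sub_sq_real n v
      rw [hn, hv, real_inner_comm] at h
      have := pow_le_one₀ (n := 2) (norm_nonneg _) hnv
      linarith
    set c : ℝ := inner ℝ v n
    have hc0 : 0 < c := by linarith
    have hmem : c⁻¹ • n - v ∈ (Submodule.span ℝ {v})ᗮ := by
      rw [Submodule.mem_orthogonal_singleton_iff_inner_right, inner_sub_right, inner_smul_right,
        real_inner_self_eq_norm_sq, hv, inv_mul_cancel₀ hc0.ne']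
      norm_num
    have hnorm : ‖c⁻¹ • n - v‖ ≤ 3 := by
      refine (norm_sub_le _ _).trans ?_
      rw [norm_smul, hn, hv, mul_one, norm_inv, Real.norm_of_nonneg hc0.le]
      have : c⁻¹ ≤ (1 / 2)⁻¹ := inv_anti₀ (by norm_num) hc
      linarith
    obtain ⟨y, hy, hyd⟩ := ht₁ ⟨_, hmem⟩ hnorm
    obtain ⟨z, hz, hzd⟩ := ht₂ (⟨_, hmem⟩ - y) hyd
    refine ⟨_, Finset.mem_image_of_mem _ hz, _, Finset.mem_image_of_mem _ hy, c⁻¹, ?_⟩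
    rw [← norm_neg]
    convert hzd using 1
    rw [Submodule.coe_norm]
    congr 1
    push_cast
    abel

/-- Two configurations are combined by translating one of them far away from the other. -/
theorem CoversDirections.exists_union {E : Type*} [NormedAddCommGroup E] [NormedSpace ℝ E]
    [Nontrivial E] {A₁ B₁ A₂ B₂ : Finset E} {S₁ S₂ : Set E} {η : ℝ}
    (h₁ : CoversDirections A₁ B₁ S₁ η) (h₂ : CoversDirections A₂ B₂ S₂ η) :
    ∃ A B : Finset E, A.card + B.card ≤ (A₁.card + B₁.card) + (A₂.card + B₂.card) ∧
      CoversDirections A B (S₁ ∪ S₂) η := by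
  classical
  obtain ⟨R, hR⟩ := (A₁ ∪ B₁ ∪ (A₂ ∪ B₂)).finite_toSet.isBounded.exists_norm_le
  simp only [SetLike.mem_coe, Finset.mem_union] at hR
  obtain ⟨w, hw⟩ := NormedSpace.exists_lt_norm ℝ E (2 * R + 1)
  have hcross : ∀ x y, ‖x‖ ≤ R → ‖y‖ ≤ R → 1 ≤ ‖x - (w + y)‖ := by
    intro x y hx hy
    have h := norm_sub_le (x - y) (x - (w + y))
    rw [show x - y - (x - (w + y)) = w by abel] at h
    have := norm_sub_le x y
    linarith
  refine ⟨A₁ ∪ A₂.image (w + ·), B₁ ∪ B₂.image (w + ·), ?_, ?_, ?_⟩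
  · have := Finset.card_union_le A₁ (A₂.image (w + ·))
    have := Finset.card_union_le B₁ (B₂.image (w + ·))
    have := Finset.card_image_le (s := A₂) (f := (w + ·))
    have := Finset.card_image_le (s := B₂) (f := (w + ·))
    omega
  · intro a ha b hb
    rcases Finset.mem_union.1 ha with ha | ha <;> rcases Finset.mem_union.1 hb with hb | hb
    · exact h₁.1 a ha b hb
    · obtain ⟨y, hy, rfl⟩ := Finset.mem_image.1 hb
      exact hcross a y (hR a (by tauto)) (hR y (by tauto))
    · obtain ⟨x, hx, rfl⟩ := Finset.mem_image.1 ha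
      rw [norm_sub_rev]
      exact hcross b x (hR b (by tauto)) (hR x (by tauto))
    · obtain ⟨x, hx, rfl⟩ := Finset.mem_image.1 ha
      obtain ⟨y, hy, rfl⟩ := Finset.mem_image.1 hb
      rw [add_sub_add_left_eq_sub]
      exact h₂.1 x hx y hy
  · rintro n (hn | hn)
    · obtain ⟨a, ha, b, hb, t, ht⟩ := h₁.2 n hn
      exact ⟨a, Finset.mem_union_left _ ha, b, Finset.mem_union_left _ hb, t, ht⟩
    · obtain ⟨a, ha, b, hb, t, ht⟩ := h₂.2 n hn
      refine ⟨w + a, Finset.mem_union_right _ (Finset.mem_image_of_mem _ ha), w + b,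
        Finset.mem_union_right _ (Finset.mem_image_of_mem _ hb), t, ?_⟩
      rwa [add_sub_add_left_eq_sub]

/-- The charts around the at most `3 ^ (k + 1)` points of a `1`-net of the unit sphere cover all
directions. -/
theorem exists_coversDirections_sphere {E : Type*} [NormedAddCommGroup E] [InnerProductSpace ℝ E]
    [FiniteDimensional ℝ E] {k : ℕ} (hE : finrank ℝ E = k + 1) {ρ : ℝ}
    (hρ0 : 0 < ρ) (hρ1 : ρ ≤ 1) :
    ∃ A B : Finset E, (A.card + B.card : ℝ) ≤ 6 * (21 / ρ) ^ k ∧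
      CoversDirections A B (Metric.sphere 0 1) (ρ ^ 2) := by
  classical
  have : Nontrivial E := Module.nontrivial_of_finrank_pos (R := ℝ) (by omega)
  obtain ⟨t, htS, ht, htc⟩ := exists_finset_net (F := E) (S := Metric.sphere 0 1) (R := 1) (r := 1)
    one_pos zero_le_one fun x hx ↦ (mem_sphere_zero_iff_norm.1 hx).le
  have key : ∀ s : Finset E, (∀ v ∈ s, ‖v‖ = 1) → ∃ A B : Finset E,
      (A.card + B.card : ℝ) ≤ s.card * (2 * (7 / ρ) ^ k) ∧
      CoversDirections A B {n | ‖n‖ = 1 ∧ ∃ v ∈ s, ‖n - v‖ ≤ 1} (ρ ^ 2) := by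
    intro s
    induction s using Finset.induction_on with
    | empty => exact fun _ ↦ ⟨∅, ∅, by simp, by simp [CoversDirections]⟩
    | insert v s hvs ih =>
      intro hs
      obtain ⟨A₁, B₁, hc₁, h₁⟩ := exists_coversDirections_near hE
        (hs v (Finset.mem_insert_self v s)) hρ0 hρ1
      obtain ⟨A₂, B₂, hc₂, h₂⟩ := ih fun u hu ↦ hs u (Finset.mem_insert_of_mem hu)
      obtain ⟨A, B, hc, h⟩ := h₁.exists_union h₂
      have hc' : (A.card + B.card : ℝ) ≤ (A₁.card + B₁.card) + (A₂.card + B₂.card) := by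
        exact_mod_cast hc
      refine ⟨A, B, ?_, h.1, ?_⟩
      · rw [Finset.card_insert_of_notMem hvs]
        push_cast
        linarith
      · rintro n ⟨hn, u, hu, hnu⟩
        refine h.2 n ?_
        rcases Finset.mem_insert.1 hu with rfl | hu
        exacts [Or.inl ⟨hn, hnu⟩, Or.inr ⟨hn, u, hu, hnu⟩]
  obtain ⟨A, B, hc, h⟩ := key t fun v hv ↦ mem_sphere_zero_iff_norm.1 (htS v hv)
  refine ⟨A, B, hc.trans ?_, h.1, fun n hn ↦ h.2 n ⟨mem_sphere_zero_iff_norm.1 hn, ht n hn⟩⟩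
  rw [hE] at htc
  calc (t.card : ℝ) * (2 * (7 / ρ) ^ k) ≤ (1 + 2 * 1 / 1) ^ (k + 1) * (2 * (7 / ρ) ^ k) := by gcongr
    _ = 6 * (3 ^ k * (7 / ρ) ^ k) := by ring
    _ = 6 * (21 / ρ) ^ k := by rw [← mul_pow]; ring

/-! ### Datasets without a preserving map -/

/-- A labeled dataset of any size `N` that is large enough is obtained by adding far away points to
one class; rescaling makes the distance between the classes equal to `δ`. -/
theorem CoversDirections.exists_dataset {d N : ℕ} (hd : 0 < d)
    {A B : Finset (EuclideanSpace ℝ (Fin d))}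
    {S : Set (EuclideanSpace ℝ (Fin d))} {η δ : ℝ} (h : CoversDirections A B S η)
    (hS : S.Nonempty) (hN : A.card + B.card ≤ N) (hδ : 0 < δ) :
    ∃ D : Dataset d N 2, D.IsSeparated δ ∧
      ∀ n ∈ S, ∃ p ∈ D.1, ∃ q ∈ D.1, p.2 ≠ q.2 ∧ ∃ t : ℝ, ‖p.1 - q.1 - t • n‖ ≤ δ * η := by
  classical
  have : Nonempty (Fin d) := ⟨⟨0, hd⟩⟩
  -- the places where points may be added to `A`
  let F : Set (EuclideanSpace ℝ (Fin d)) := {x | ∀ b ∈ B, 1 ≤ ‖x - b‖}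
  have hF : F.Infinite := by
    intro hfin
    obtain ⟨R, hR⟩ := hfin.isBounded.exists_norm_le
    obtain ⟨R', hR'⟩ := B.finite_toSet.isBounded.exists_norm_le
    obtain ⟨w, hw⟩ := NormedSpace.exists_lt_norm ℝ (EuclideanSpace ℝ (Fin d)) (max R (R' + 1))
    refine ((le_max_left R _).trans_lt hw).not_ge (hR w fun b hb ↦ ?_)
    have := norm_sub_norm_le w b
    have := hR' b hb
    have := (le_max_right R _).trans_lt hw
    linarith
  obtain ⟨P, hPF, hPc⟩ := (hF.sdiff A.finite_toSet).exists_subset_card_eq (N - (A.card + B.card))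
  have hdisj : Disjoint A P := Finset.disjoint_right.2 fun x hx hxA ↦ (hPF hx).2 hxA
  set A' := A ∪ P
  have hA' : ∀ a ∈ A', ∀ b ∈ B, 1 ≤ ‖a - b‖ := by
    intro a ha
    rcases Finset.mem_union.1 ha with ha | ha
    exacts [h.1 a ha, (hPF ha).1]
  obtain ⟨n₀, hn₀⟩ := hS
  obtain ⟨a₀, ha₀, b₀, hb₀, -⟩ := h.2 n₀ hn₀
  have hAA' : A ⊆ A' := Finset.subset_union_left
  obtain ⟨⟨a₁, b₁⟩, hab₁, hmin⟩ := (A' ×ˢ B).exists_min_image (fun ab ↦ ‖ab.1 - ab.2‖)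
    ⟨(a₀, b₀), Finset.mk_mem_product (hAA' ha₀) hb₀⟩
  rw [Finset.mem_product] at hab₁
  set m := ‖a₁ - b₁‖
  have hm : 1 ≤ m := hA' a₁ hab₁.1 b₁ hab₁.2
  set c := δ / m
  have hc0 : 0 < c := by positivity
  have hcδ : c ≤ δ := div_le_self hδ.le hm
  have hinj : ∀ i : Fin 2, Function.Injective
      fun x : EuclideanSpace ℝ (Fin d) ↦ ((c • x, i) : EuclideanSpace ℝ (Fin d) × Fin 2) :=
    fun i x y hxy ↦ smul_right_injective _ hc0.ne' (congrArg Prod.fst hxy)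
  let D : Finset (EuclideanSpace ℝ (Fin d) × Fin 2) :=
    A'.image (fun x ↦ (c • x, 0)) ∪ B.image fun x ↦ (c • x, 1)
  have hmemA : ∀ a ∈ A', (c • a, (0 : Fin 2)) ∈ D := fun a ha ↦
    Finset.mem_union_left _ (Finset.mem_image_of_mem _ ha)
  have hmemB : ∀ b ∈ B, (c • b, (1 : Fin 2)) ∈ D := fun b hb ↦
    Finset.mem_union_right _ (Finset.mem_image_of_mem _ hb)
  have hcard : D.card = N := by
    rw [Finset.card_union_of_disjoint, Finset.card_image_of_injective _ (hinj 0),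
      Finset.card_image_of_injective _ (hinj 1), Finset.card_union_of_disjoint hdisj, hPc]
    · omega
    · rw [Finset.disjoint_left]
      intro x hx hx'
      obtain ⟨a, -, rfl⟩ := Finset.mem_image.1 hx
      obtain ⟨b, -, hb⟩ := Finset.mem_image.1 hx'
      exact one_ne_zero (congrArg Prod.snd hb)
  have hdist : ∀ a ∈ A', ∀ b ∈ B, δ ≤ ‖c • a - c • b‖ := by
    intro a ha b hb
    rw [← smul_sub, norm_smul, Real.norm_of_nonneg hc0.le]
    calc δ = c * m := (div_mul_cancel₀ _ (by linarith)).symm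
      _ ≤ _ := mul_le_mul_of_nonneg_left (hmin (a, b) (Finset.mk_mem_product ha hb)) hc0.le
  refine ⟨⟨D, hcard⟩, ⟨⟨_, hmemA a₁ hab₁.1, _, hmemB b₁ hab₁.2, zero_ne_one, ?_⟩, ?_⟩, ?_⟩
  · rw [← smul_sub, norm_smul, Real.norm_of_nonneg hc0.le]
    exact (div_mul_cancel₀ _ (by linarith)).symm
  · rintro _ ⟨p, hp, q, hq, hpq, rfl⟩
    rcases Finset.mem_union.1 hp with hp | hp <;> rcases Finset.mem_union.1 hq with hq | hq <;>
      obtain ⟨x, hx, rfl⟩ := Finset.mem_image.1 hp <;>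
      obtain ⟨y, hy, rfl⟩ := Finset.mem_image.1 hq
    · exact absurd rfl hpq
    · exact hdist x hx y hy
    · rw [norm_sub_rev]; exact hdist y hy x hx
    · exact absurd rfl hpq
  · intro n hn
    obtain ⟨a, ha, b, hb, t, ht⟩ := h.2 n hn
    refine ⟨_, hmemA a (hAA' ha), _, hmemB b hb, zero_ne_one, c * t, ?_⟩
    rw [← smul_sub, mul_smul, ← smul_sub, norm_smul, Real.norm_of_nonneg hc0.le]
    exact mul_le_mul hcδ ht (norm_nonneg _) hδ.le

/-- If a vector of the kernel of `T` spans a line within `2 σ` of a difference of differently labeled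
points, then `T` identifies two distinct points of their `σ`-balls. -/
theorem Dataset.not_preserves_of_map_eq_zero {d N C : ℕ} {D : Dataset d N C} {σ δ : ℝ}
    (hσ : 2 * σ < δ) (hD : D.IsSeparated δ) {F : Type*} [NormedAddCommGroup F] [NormedSpace ℝ F]
    {T : EuclideanSpace ℝ (Fin d) →ₗ[ℝ] F} {n : EuclideanSpace ℝ (Fin d)} (hn : T n = 0)
    {p q : EuclideanSpace ℝ (Fin d) × Fin C} (hp : p ∈ D.1) (hq : q ∈ D.1) (hpq : p.2 ≠ q.2)
    {t : ℝ} (ht : ‖p.1 - q.1 - t • n‖ ≤ 2 * σ) : ¬ D.Preserves σ T := by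
  intro hT
  have hδ : δ ≤ ‖p.1 - q.1‖ := hD.2 ⟨p, hp, q, hq, hpq, rfl⟩
  set w := p.1 - q.1 - t • n with hw
  -- moving both points by `w / 2` towards each other turns their difference into `t • n`
  have hhalf : ‖(2⁻¹ : ℝ) • w‖ ≤ σ := by
    rw [norm_smul, Real.norm_of_nonneg (by norm_num)]
    linarith
  have h := hT p hp q hq hpq (p.1 - (2⁻¹ : ℝ) • w) (by simpa [mem_closedBall_iff_norm] using hhalf)
    (q.1 + (2⁻¹ : ℝ) • w) (by simpa [mem_closedBall_iff_norm] using hhalf)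
  have hdiff : p.1 - (2⁻¹ : ℝ) • w - (q.1 + (2⁻¹ : ℝ) • w) = t • n := by
    rw [hw]; module
  rw [← map_sub, hdiff, map_smul, hn, smul_zero, norm_zero, norm_le_zero_iff] at h
  rw [h, sub_zero] at hw
  rw [hw] at ht
  linarith

theorem exists_isSeparated_not_hasPreservingMap {d N k : ℕ} (hN : 0 < N) (hk0 : 0 < k) (hk : k < d)
    {σ δ : ℝ} (hδ : 0 < δ) (hσδ : σ < δ / 2)
    (hσ : 7938 * (N : ℝ) ^ (-(2 / (k : ℝ))) < σ / δ) :
    ∃ D : Dataset d N 2, D.IsSeparated δ ∧ ¬ D.HasPreservingMap σ k := by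
  classical
  have hk0' : (0 : ℝ) < k := by exact_mod_cast hk0
  have hN0 : (0 : ℝ) < N := by exact_mod_cast hN
  -- `6 * (21 / ρ) ^ k ≤ N` holds for this `ρ`, and `ρ ^ 2 ≤ 2 * σ / δ`
  set ρ : ℝ := 126 * (N : ℝ) ^ (-(1 / (k : ℝ))) with hρ
  have hρ0 : 0 < ρ := by positivity
  have hρsq : ρ ^ 2 = 2 * (7938 * (N : ℝ) ^ (-(2 / (k : ℝ)))) := by
    rw [hρ, mul_pow, ← Real.rpow_natCast ((N : ℝ) ^ _), ← Real.rpow_mul hN0.le]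
    rw [show -(1 / (k : ℝ)) * (2 : ℕ) = -(2 / (k : ℝ)) by push_cast; ring]
    ring
  have hσδ' : σ / δ < 1 / 2 := by
    rw [div_lt_iff₀ hδ]; linarith
  have hρ1 : ρ ≤ 1 := by
    have : ρ ^ 2 ≤ 1 := by linarith
    exact (sq_le_one_iff₀ hρ0.le).1 this
  have hρσ : δ * ρ ^ 2 ≤ 2 * σ := by
    have := (lt_div_iff₀ hδ).1 hσ
    rw [hρsq]
    linarith
  obtain ⟨A, B, hc, h⟩ := exists_coversDirections_sphere (E := EuclideanSpace ℝ (Fin (k + 1)))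
    (k := k) (by simp) hρ0 hρ1
  have hcN : A.card + B.card ≤ N := by
    have hρk : (21 / ρ) ^ k = N / 6 ^ k := by
      have h1 : 21 / ρ = (N : ℝ) ^ (1 / (k : ℝ)) / 6 := by
        rw [hρ, Real.rpow_neg hN0.le]
        have := Real.rpow_pos_of_pos hN0 (1 / (k : ℝ))
        field_simp
        norm_num
      rw [h1, div_pow, ← Real.rpow_natCast ((N : ℝ) ^ _), ← Real.rpow_mul hN0.le,
        div_mul_cancel₀ _ hk0'.ne', Real.rpow_one]
    have h6 : (6 : ℝ) ≤ 6 ^ k := le_self_pow₀ (by norm_num) hk0.ne'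
    have : (A.card + B.card : ℝ) ≤ N := by
      refine hc.trans ?_
      rw [hρk, mul_div_assoc', div_le_iff₀ (by positivity), mul_comm]
      gcongr
    exact_mod_cast this
  -- the configuration is placed in the span of the first `k + 1` coordinate vectors
  let e := EuclideanSpace.basisFun (Fin d) ℝ
  let ι : EuclideanSpace ℝ (Fin (k + 1)) →ₗᵢ[ℝ] EuclideanSpace ℝ (Fin d) :=
    ((EuclideanSpace.basisFun (Fin (k + 1)) ℝ).toBasis.constr ℝ
      (e ∘ Fin.castLE hk)).isometryOfOrthonormal
      (v := (EuclideanSpace.basisFun (Fin (k + 1)) ℝ).toBasis)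
      (by simp)
      (by
        have : (⇑((EuclideanSpace.basisFun (Fin (k + 1)) ℝ).toBasis.constr ℝ
          (e ∘ Fin.castLE hk)) ∘ ⇑(EuclideanSpace.basisFun (Fin (k + 1)) ℝ).toBasis) =
            e ∘ Fin.castLE hk := by
          funext i
          exact Basis.constr_basis _ _ _ _
        rw [this]
        exact e.orthonormal.comp _ (Fin.castLE_injective hk))
  have hι : CoversDirections (A.image ι) (B.image ι) (ι '' Metric.sphere 0 1) (ρ ^ 2) := by
    refine ⟨?_, ?_⟩
    · intro a ha b hb
      obtain ⟨x, hx, rfl⟩ := Finset.mem_image.1 ha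
      obtain ⟨y, hy, rfl⟩ := Finset.mem_image.1 hb
      rw [← map_sub, ι.norm_map]
      exact h.1 x hx y hy
    · rintro _ ⟨n, hn, rfl⟩
      obtain ⟨a, ha, b, hb, t, ht⟩ := h.2 n hn
      refine ⟨_, Finset.mem_image_of_mem _ ha, _, Finset.mem_image_of_mem _ hb, t, ?_⟩
      rwa [← map_sub, ← map_smul, ← map_sub, ι.norm_map]
  obtain ⟨D, hD, hDS⟩ := hι.exists_dataset (N := N) (by omega)
    ((NormedSpace.sphere_nonempty.2 zero_le_one).image ι)
    ((Nat.add_le_add Finset.card_image_le Finset.card_image_le).trans hcN) hδ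
  refine ⟨D, hD, ?_⟩
  rintro ⟨T, hT⟩
  obtain ⟨x, hx, hx0⟩ := Submodule.exists_mem_ne_zero_of_ne_bot
    (LinearMap.ker_ne_bot_of_finrank_lt (f := T ∘ₗ ι.toLinearMap) (by simp))
  obtain ⟨p, hp, q, hq, hpq, t, ht⟩ := hDS (ι (‖x‖⁻¹ • x))
    ⟨_, by simp [norm_smul, hx0], rfl⟩
  refine D.not_preserves_of_map_eq_zero (by linarith) hD (n := ι (‖x‖⁻¹ • x)) ?_ hp hq hpq
    (ht.trans hρσ) hT
  have : T (ι x) = 0 := hx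
  rw [map_smul, map_smul, this, smul_zero]

theorem mainTheorem3 :
    ∃ C₁ C₂ : ℝ, 0 < C₁ ∧ 0 < C₂ ∧
      ∀ N d C k : ℕ, 2 ≤ N → 2 ≤ d → 2 ≤ C → 1 ≤ k → k + 1 ≤ d →
      ∀ σ δ : ℝ, 0 ≤ σ → 0 < δ → σ < δ / 2 →
        (σ / δ < C₁ * √((k : ℝ) / (d : ℝ)) * (N : ℝ) ^ (-(2 / (k : ℝ))) →
          ∀ D : Dataset d N C, D.IsSeparated δ →
            D.HasPreservingMap σ k ∧
            D.IsOrthogonallyPreservable σ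
              (2 * C₁ * √((k : ℝ) / (d : ℝ)) * (N : ℝ) ^ (-(2 / (k : ℝ)))) k) ∧
        (C₂ * (N : ℝ) ^ (-(2 / (k : ℝ))) < σ / δ →
          ∃ D : Dataset d N 2, D.IsSeparated δ ∧ ¬ D.HasPreservingMap σ k) := by
  refine ⟨1 / 12, 7938, by norm_num, by norm_num, ?_⟩
  intro N d C k hN _ _ hk hkd σ δ _ hδ hσδ
  refine ⟨fun hσ D hD ↦ ?_, fun hσ ↦ ?_⟩
  · have h := hD.isOrthogonallyPreservable (by omega) hk hkd hδ hσ
    exact ⟨h.hasPreservingMap, h⟩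
  · exact exists_isSeparated_not_hasPreservingMap (by omega) hk hkd hδ hσδ hσ
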